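/- Let $n\ge 1$, $m\ge 1$, $K\ge 1$ be integers, $\alpha\in(0,1)$, and write $[\ell]=\{1,\dots,\ell\}$. Let $(X_i,Y_i)$, $i\in[n+m]$, be random pairs with $X_i$ in a measurable space $\mathcal X$ and $Y_i\in[K]$; the first $n$ pairs form the calibration sample, the last $m$ the batch. Let $S_k:\mathcal X\to\mathbb R$, $k\in[K]$, be fixed measurable score functions, and assume that almost surely the scores $S_{Y_i}(X_i)$, $i\in[n+m]$, are pairwise distinct. For $k\in[K]$ and $i\in[m]$ let $$p_i^{(k)}=\frac{1}{|D^{(k)}|+1}\Big(1+\sum_{j\in D^{(k)}}\mathbf 1\{S_{Y_j}(X_j)\ge S_k(X_{n+i})\}\Big),$$ where $D^{(k)}=[n]$ for full-calibrated $p$-values and $D^{(k)}=\{j\in[n]:Y_j=k\}$ for class-calibrated $p$-values. For $y=(y_i)_{i\in[m]}\in[K]^m$ let $p_{(1)}(y)\le\dots\le p_{(m)}(y)$ be the ordered values of $(p_i^{(y_i)})_{i\in[m]}$, and define the Simes batch prediction set $$\mathcal C=\Big\{y\in[K]^m:\ \min_{\ell\in[m]}\frac{m\,p_{(\ell)}(y)}{\ell}>\alpha\Big\}.$$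 (i) (iid model.) If the pairs $(X_i,Y_i)$, $i\in[n+m]$, are independent and identically distributed, $\mathcal C$ is built from the full-calibrated $p$-values and $\alpha(n+1)/m$ is an integer, then $\mathbb P\big((Y_{n+i})_{i\in[m]}\in\mathcal C\big)=1-\alpha$. (ii) (Conditional model.) Suppose that, given $(Y_j)_{j\in[n+m]}$, the covariates $X_1,\dots,X_{n+m}$ are independent and the conditional law of $X_i$ depends only on the class $Y_i$, through a law that is common to all $i$; the joint law of the labels is arbitrary. Let $\mathcal C$ be built from the class-calibrated $p$-values. Then for every label vector $y\in[K]^{n+m}$ with $\mathbb P((Y_j)_{j\in[n+m]}=y)>0$ such that, with $n_k=|\{j\in[n]:y_j=k\}|$, the number $\alpha(n_k+1)/m$ is an integer for every $k\in[K]$, $$\mathbb P\big((Y_{n+i})_{i\in[m]}\in\mathcal C\ \big|\ (Y_j)_{j\in[n+m]}=y\big)=1-\alpha.$$ -/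

import Mathlib

open MeasureTheory ProbabilityTheory

noncomputable section

/-- The conformal `p`-value of test point `i` for the label `k`, where `S` are the score functions,
`D k` is the set of calibration indices used for label `k`, `x` is the vector of all `n + m`
covariates and `yc` is the vector of the `n` calibration labels. -/
def conformalPValue {𝒳 : Type*} {n m K : ℕ} (S : Fin K → 𝒳 → ℝ) (D : Fin K → Finset (Fin n))
    (x : Fin (n + m) → 𝒳) (yc : Fin n → Fin K) (k : Fin K) (i : Fin m) : ℝ :=
  (1 / (((D k).card : ℝ) + 1)) *
    (1 + ∑ j ∈ D k, if S k (x (Fin.natAdd n i)) ≤ S (yc j) (x (Fin.castAdd m j))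
      then (1 : ℝ) else 0)

/-- The calibration indices with label `k`. -/
def classIndices {n K : ℕ} (yc : Fin n → Fin K) (k : Fin K) : Finset (Fin n) :=
  Finset.univ.filter fun j => yc j = k

/-- Full-calibrated `p`-values: every calibration point is used for every label. -/
def fullPValue {𝒳 : Type*} {n m K : ℕ} (S : Fin K → 𝒳 → ℝ)
    (x : Fin (n + m) → 𝒳) (yc : Fin n → Fin K) (k : Fin K) (i : Fin m) : ℝ :=
  conformalPValue S (fun _ => Finset.univ) x yc k i

/-- Class-calibrated `p`-values: only the calibration points of class `k` are used for `k`. -/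
def classPValue {𝒳 : Type*} {n m K : ℕ} (S : Fin K → 𝒳 → ℝ)
    (x : Fin (n + m) → 𝒳) (yc : Fin n → Fin K) (k : Fin K) (i : Fin m) : ℝ :=
  conformalPValue S (classIndices yc) x yc k i

/-- The entry of rank `l` (ranks starting at `0`) of `p`, in increasing order. -/
def orderStat {m : ℕ} (p : Fin m → ℝ) (l : Fin m) : ℝ := p (Tuple.sort p l)

/-- The Simes combination `min_{1 ≤ ℓ ≤ m} m p_{(ℓ)} / ℓ` (used for `m ≥ 1` only). -/
def simesCombination {m : ℕ} (p : Fin m → ℝ) : ℝ :=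
  ⨅ l : Fin m, (m : ℝ) * orderStat p l / ((l : ℕ) + 1 : ℝ)

/-- The Simes batch prediction set at level `α`, for the family `p k i` of `p`-values
(label `k`, test point `i`). -/
def simesSet {m K : ℕ} (α : ℝ) (p : Fin K → Fin m → ℝ) : Set (Fin m → Fin K) :=
  {y | α < simesCombination fun i => p (y i) i}

/-- The event that the vector of batch labels lies in the Simes set built from the full-calibrated
`p`-values. The set itself only uses the covariates and the calibration labels. -/
def fullCoverEvent {Ω 𝒳 : Type*} {n m K : ℕ} (S : Fin K → 𝒳 → ℝ) (α : ℝ)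
    (X : Fin (n + m) → Ω → 𝒳) (Y : Fin (n + m) → Ω → Fin K) : Set Ω :=
  {ω | (fun i : Fin m => Y (Fin.natAdd n i) ω) ∈
    simesSet α (fullPValue S (fun i => X i ω) (fun j : Fin n => Y (Fin.castAdd m j) ω))}

/-- The same event for the class-calibrated `p`-values. -/
def classCoverEvent {Ω 𝒳 : Type*} {n m K : ℕ} (S : Fin K → 𝒳 → ℝ) (α : ℝ)
    (X : Fin (n + m) → Ω → 𝒳) (Y : Fin (n + m) → Ω → Fin K) : Set Ω :=
  {ω | (fun i : Fin m => Y (Fin.natAdd n i) ω) ∈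
    simesSet α (classPValue S (fun i => X i ω) (fun j : Fin n => Y (Fin.castAdd m j) ω))}

/-- The event that the vector of all labels is `y`. -/
def labelEvent {Ω : Type*} {N K : ℕ} (Y : Fin N → Ω → Fin K) (y : Fin N → Fin K) : Set Ω :=
  {ω | ∀ i, Y i ω = y i}

/-- The iid model: the pairs `(X i, Y i)` are independent and identically distributed. -/
structure IsIIDModel {Ω 𝒳 : Type*} [MeasurableSpace Ω] [MeasurableSpace 𝒳] {N K : ℕ}
    (μ : Measure Ω) (X : Fin N → Ω → 𝒳) (Y : Fin N → Ω → Fin K) : Prop where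
  indep : iIndepFun (fun i ω => (X i ω, Y i ω)) μ
  ident : ∀ i j, IdentDistrib (fun ω => (X i ω, Y i ω)) (fun ω => (X j ω, Y j ω)) μ μ

/-- The conditional model: given the label vector, the covariates are independent, and the law of
the `i`-th one depends only on the `i`-th label (`Q k` is the law of a covariate of class `k`).
Nothing is assumed on the law of the labels, which may be deterministic. -/
def IsConditionalModel {Ω 𝒳 : Type*} [MeasurableSpace Ω] [MeasurableSpace 𝒳] {N K : ℕ}
    (μ : Measure Ω) (X : Fin N → Ω → 𝒳) (Y : Fin N → Ω → Fin K) : Prop :=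
  ∃ Q : Fin K → Measure 𝒳, ∀ y : Fin N → Fin K, μ (labelEvent Y y) ≠ 0 →
    iIndepFun X (μ[|labelEvent Y y]) ∧ ∀ i, (μ[|labelEvent Y y]).map (X i) = Q (y i)

end

/-! The Simes statistic is at most α exactly when the step-up (Benjamini–Hochberg) procedure with
slope t = α/m rejects something. If R is its number of rejections, the indicator of R > 0 is the sum
over i of 1{p_i ≤ tR}/R, so it suffices that each term has expectation exactly α/m. Fix i and let W
be its window: i and the calibration points of its group, of size M. Scores are exchangeable within
groups, so M times this expectation is the expected sum of the weights of i over all swaps of i with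
a point of W. That sum is deterministic (`sum_stepUpWeight_of_bijOn`). Without ties, p_i runs
through 1/M, …, M/M. Lowering p_i changes other p-values only below the old p_i, so R is constant,
say R₀, on the swaps rejecting i. As tM = c is an integer, these are exactly the cR₀ lowest ranks,
and the sum is cR₀/R₀ = c. The iid model uses a single group; the conditional model groups by label,
given the labels. -/

open scoped ENNReal

/-! ### Step-up procedure and Simes test -/

/-- The number of entries of `p` that are at most `s`. -/
noncomputable def belowCount {m : ℕ} (p : Fin m → ℝ) (s : ℝ) : ℕ :=
  (Finset.univ.filter fun i => p i ≤ s).card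

/-- The number of rejections of the step-up procedure with critical values `t * l`. -/
noncomputable def stepUpCount {m : ℕ} (t : ℝ) (p : Fin m → ℝ) : ℕ :=
  Nat.findGreatest (fun l => l ≤ belowCount p (t * l)) m

/-- The indicator that `i` is rejected by the step-up procedure, divided by the number of
rejections. -/
noncomputable def stepUpWeight {m : ℕ} (t : ℝ) (i : Fin m) (p : Fin m → ℝ) : ℝ≥0∞ :=
  if p i ≤ t * stepUpCount t p then (stepUpCount t p : ℝ≥0∞)⁻¹ else 0

lemma belowCount_le {m : ℕ} (p : Fin m → ℝ) (s : ℝ) : belowCount p s ≤ m :=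
  (Finset.card_le_univ _).trans_eq (Fintype.card_fin m)

lemma belowCount_mono {m : ℕ} (p : Fin m → ℝ) : Monotone (belowCount p) := fun _ _ h =>
  Finset.card_le_card fun _ => by simpa using fun h' => h'.trans h

lemma stepUpCount_le {m : ℕ} (t : ℝ) (p : Fin m → ℝ) : stepUpCount t p ≤ m :=
  Nat.findGreatest_le m

lemma le_stepUpCount {m : ℕ} {t : ℝ} {p : Fin m → ℝ} {l : ℕ} (h : l ≤ belowCount p (t * l)) :
    l ≤ stepUpCount t p :=
  Nat.le_findGreatest (h.trans (belowCount_le _ _)) h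

lemma stepUpCount_le_belowCount {m : ℕ} (t : ℝ) (p : Fin m → ℝ) :
    stepUpCount t p ≤ belowCount p (t * stepUpCount t p) :=
  Nat.findGreatest_spec (P := fun l => l ≤ belowCount p (t * l)) (Nat.zero_le m) (Nat.zero_le _)

/-- The number of entries below the threshold is itself admissible, by monotonicity, so maximality
forces equality. -/
lemma belowCount_stepUpCount {m : ℕ} {t : ℝ} (ht : 0 ≤ t) (p : Fin m → ℝ) :
    belowCount p (t * stepUpCount t p) = stepUpCount t p := by
  refine le_antisymm (le_stepUpCount (belowCount_mono p ?_)) (stepUpCount_le_belowCount t p)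
  gcongr
  exact stepUpCount_le_belowCount t p

lemma sum_stepUpWeight {m : ℕ} {t : ℝ} (ht : 0 ≤ t) (p : Fin m → ℝ) :
    ∑ i, stepUpWeight t i p = if 0 < stepUpCount t p then 1 else 0 := by
  have h := belowCount_stepUpCount ht p
  unfold belowCount at h
  unfold stepUpWeight
  rw [← Finset.sum_filter, Finset.sum_const, h, nsmul_eq_mul]
  split_ifs with h0
  · exact ENNReal.mul_inv_cancel (by exact_mod_cast h0.ne') (ENNReal.natCast_ne_top _)
  -- With no rejection the product is `0 * ⊤`, which is `0` in `ℝ≥0∞`.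
  · simp [Nat.eq_zero_of_not_pos h0]

lemma measurable_belowCount {m : ℕ} (s : ℝ) :
    Measurable fun p : Fin m → ℝ => belowCount p s := by
  simp only [belowCount, Finset.card_filter]
  refine Finset.measurable_sum _ fun i _ => Measurable.ite ?_ measurable_const measurable_const
  exact measurableSet_le (measurable_pi_apply i) measurable_const

lemma measurable_stepUpCount {m : ℕ} (t : ℝ) :
    Measurable fun p : Fin m → ℝ => stepUpCount t p :=
  measurable_findGreatest fun _ _ => measurableSet_le measurable_const (measurable_belowCount _)

lemma measurable_stepUpWeight {m : ℕ} (t : ℝ) (i : Fin m) :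
    Measurable fun p : Fin m → ℝ => stepUpWeight t i p := by
  have hR := measurable_stepUpCount (m := m) t
  refine Measurable.ite (measurableSet_le (measurable_pi_apply i) ?_) ?_ measurable_const
  · exact measurable_const.mul (measurable_from_top.comp hR)
  · exact (measurable_from_top (f := fun k : ℕ => (k : ℝ≥0∞)⁻¹)).comp hR

lemma orderStat_le_iff {m : ℕ} (p : Fin m → ℝ) (l : Fin m) (s : ℝ) :
    orderStat p l ≤ s ↔ (l : ℕ) + 1 ≤ belowCount p s := by
  have h := Tuple.lt_card_le_iff_apply_le_of_monotone (j := l) (f := p ∘ Tuple.sort p) (a := s)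
    (Tuple.monotone_sort p)
  have hc : (Finset.univ.filter fun i => (p ∘ Tuple.sort p) i ≤ s).card = belowCount p s :=
    Finset.card_equiv (Tuple.sort p) fun i => by simp
  rw [Nat.succ_le_iff, ← hc]
  exact h.symm

lemma simesCombination_le_iff {m : ℕ} (hm : 1 ≤ m) (α : ℝ) (p : Fin m → ℝ) :
    simesCombination p ≤ α ↔ 0 < stepUpCount (α / m) p := by
  have hm0 : (0 : ℝ) < m := by exact_mod_cast hm
  have : Nonempty (Fin m) := ⟨⟨0, hm⟩⟩
  have key : ∀ l : Fin m, (m : ℝ) * orderStat p l / ((l : ℕ) + 1 : ℝ) ≤ α ↔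
      (l : ℕ) + 1 ≤ belowCount p (α / m * ((l + 1 : ℕ) : ℝ)) := fun l => by
    rw [← orderStat_le_iff, div_le_iff₀ (by positivity), div_mul_eq_mul_div, le_div_iff₀ hm0,
      mul_comm (m : ℝ)]
    push_cast
    rfl
  constructor
  · intro h
    obtain ⟨l, hl⟩ := exists_eq_ciInf_of_finite
      (f := fun l : Fin m => (m : ℝ) * orderStat p l / ((l : ℕ) + 1 : ℝ))
    exact (Nat.succ_pos _).trans_le (le_stepUpCount ((key l).1 (hl.trans_le h)))
  · intro h
    have h1 : stepUpCount (α / m) p - 1 + 1 = stepUpCount (α / m) p := Nat.sub_add_cancel h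
    have h2 := stepUpCount_le (α / m) p
    refine (ciInf_le (Set.finite_range _).bddBelow
      (⟨stepUpCount (α / m) p - 1, by omega⟩ : Fin m)).trans ((key _).2 ?_)
    simp only [h1]
    exact stepUpCount_le_belowCount _ p

/-! ### Deterministic sum of weights over the grid -/

lemma belowCount_eq_of_eq_or_le {m : ℕ} {p q : Fin m → ℝ} {s u : ℝ}
    (h : ∀ l, q l = p l ∨ (q l ≤ u ∧ p l ≤ u)) (hu : u ≤ s) :
    belowCount q s = belowCount p s := by
  unfold belowCount
  congr 1
  refine Finset.filter_congr fun l _ => ?_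
  rcases h l with h | ⟨h1, h2⟩
  · rw [h]
  · exact ⟨fun _ => h2.trans hu, fun _ => h1.trans hu⟩

/-- If the value at `i` runs through the uniform grid `1 / M, …, M / M` and lowering it only
affects entries below it, then the step-up weights of `i` add up to `M * t`. -/
lemma sum_stepUpWeight_of_bijOn {ι : Type*} {m M c : ℕ} {t : ℝ} (W : Finset ι) (r : ι → ℕ)
    (hr : Set.BijOn r W (Set.Icc 1 M)) (p : ι → Fin m → ℝ) (i : Fin m)
    (hM : 0 < M) (hc : 0 < c) (hcM : c * m ≤ M) (ht : t * M = c)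
    (hpi : ∀ a ∈ W, p a i = r a / M)
    (hp : ∀ a ∈ W, ∀ a' ∈ W, r a' ≤ r a →
      ∀ l, p a' l = p a l ∨ (p a' l ≤ p a i ∧ p a l ≤ p a i)) :
    ∑ a ∈ W, stepUpWeight t i (p a) = c := by
  have hM0 : (0 : ℝ) < M := by exact_mod_cast hM
  have ht' : t = c / M := by field_simp; exact ht
  have ht0 : 0 ≤ t := by rw [ht']; positivity
  have hle : ∀ a ∈ W, ∀ k : ℕ, p a i ≤ t * k ↔ r a ≤ c * k := fun a ha k => by
    rw [hpi a ha, ht', div_mul_eq_mul_div, div_le_div_iff_of_pos_right hM0]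
    exact_mod_cast Iff.rfl
  set R : ι → ℕ := fun a => stepUpCount t (p a) with hR
  -- Once i is rejected at `a`, lowering its value leaves all counts at thresholds from `R a` on
  -- unchanged.
  have hconst : ∀ a ∈ W, r a ≤ c * R a → ∀ a' ∈ W, r a' ≤ r a → R a' = R a := by
    intro a ha h a' ha' haa
    have hcount : ∀ l : ℕ, R a ≤ l → belowCount (p a') (t * l) = belowCount (p a) (t * l) :=
      fun l hl => belowCount_eq_of_eq_or_le (hp a ha a' ha' haa)
        ((hle a ha l).2 (h.trans (Nat.mul_le_mul_left c hl)))
    have h1 : R a ≤ R a' := le_stepUpCount (by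
      rw [hcount _ le_rfl]; exact stepUpCount_le_belowCount t (p a))
    refine le_antisymm (le_stepUpCount ?_) h1
    rw [← hcount _ h1]
    exact stepUpCount_le_belowCount t (p a')
  have hup : ∀ a' ∈ W, ∀ a ∈ W, r a' ≤ r a → r a ≤ c * R a' → r a ≤ c * R a := by
    intro a' ha' a ha haa h
    refine h.trans (Nat.mul_le_mul_left c (le_stepUpCount ?_))
    rw [← belowCount_eq_of_eq_or_le (hp a ha a' ha' haa) ((hle a ha _).2 h)]
    exact stepUpCount_le_belowCount t (p a')
  -- The lowest grid value 1/M is at most t = c/M, so some configuration rejects i.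
  obtain ⟨b, hb, hb1⟩ := hr.surjOn (show 1 ∈ Set.Icc 1 M from ⟨le_rfl, hM⟩)
  have hRb : 0 < R b := by
    refine le_stepUpCount (l := 1) (Finset.card_pos.2 ⟨i, ?_⟩)
    simp only [Finset.mem_filter, Finset.mem_univ, true_and]
    rw [hle b hb, hb1]
    omega
  obtain ⟨a, haB, hmax⟩ := (W.filter fun a => r a ≤ c * R a).exists_max_image r
    ⟨b, Finset.mem_filter.2 ⟨hb, by rw [hb1]; exact Nat.mul_pos hc hRb⟩⟩
  obtain ⟨ha, haR⟩ := Finset.mem_filter.1 haB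
  have hab : r b ≤ r a := by rw [hb1]; exact (hr.mapsTo ha).1
  have hRa : 0 < R a := by rw [← hconst a ha haR b hb hab]; exact hRb
  have hraM : c * R a ≤ M := (Nat.mul_le_mul_left c (stepUpCount_le t (p a))).trans hcM
  obtain ⟨d, hd, hdr⟩ := hr.surjOn (show c * R a ∈ Set.Icc 1 M from ⟨Nat.mul_pos hc hRa, hraM⟩)
  -- The largest rejected rank sits on the threshold: the grid point `c * R a` exists because `c * m
  -- ≤ M`, and `hup` shows that it is rejected too.
  have hra : r a = c * R a := by
    refine le_antisymm haR ?_
    rw [← hdr]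
    exact hmax d (Finset.mem_filter.2 ⟨hd, hup a ha d hd (by omega) hdr.le⟩)
  have hfilter : (W.filter fun x => r x ≤ c * R x) = W.filter fun x => r x ≤ c * R a := by
    refine Finset.filter_congr fun x hx => ⟨fun h => ?_, fun h => ?_⟩
    · rw [← hra]; exact hmax x (Finset.mem_filter.2 ⟨hx, h⟩)
    · rw [hconst a ha haR x hx (by omega)]; exact h
  have hcard : (W.filter fun x => r x ≤ c * R a).card = c * R a := by
    have hIcc : (Finset.Icc 1 (c * R a)).card = c * R a := by simp
    refine Eq.trans ?_ hIcc
    refine Finset.card_nbij r ?_ ?_ ?_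
    · intro x hx
      obtain ⟨hx, h⟩ := Finset.mem_filter.1 hx
      exact Finset.mem_Icc.2 ⟨(hr.mapsTo hx).1, h⟩
    · exact hr.injOn.mono fun x hx => (Finset.mem_filter.1 hx).1
    · intro k hk
      obtain ⟨h1, h2⟩ := Finset.mem_Icc.1 hk
      obtain ⟨x, hx, rfl⟩ := hr.surjOn (show k ∈ Set.Icc 1 M from ⟨h1, h2.trans hraM⟩)
      exact ⟨x, Finset.mem_filter.2 ⟨hx, h2⟩, rfl⟩
  calc ∑ x ∈ W, stepUpWeight t i (p x)
      = ∑ x ∈ W.filter (fun x => r x ≤ c * R x), (R x : ℝ≥0∞)⁻¹ := by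
        rw [Finset.sum_filter]
        refine Finset.sum_congr rfl fun x hx => ?_
        unfold stepUpWeight
        simp only [hle x hx]
        rfl
    _ = ∑ x ∈ W.filter (fun x => r x ≤ c * R a), (R a : ℝ≥0∞)⁻¹ := by
        rw [hfilter]
        refine Finset.sum_congr rfl fun x hx => ?_
        obtain ⟨hx, h⟩ := Finset.mem_filter.1 hx
        rw [hconst a ha haR x hx (by omega)]
    _ = c := by
        rw [Finset.sum_const, hcard, nsmul_eq_mul, Nat.cast_mul, mul_assoc,
          ENNReal.mul_inv_cancel (by exact_mod_cast hRa.ne') (ENNReal.natCast_ne_top _), mul_one]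

/-! ### Ranks of scores in a finite window -/

section Rank

variable {ι : Type*}

/-- The rank of `a` in `W`, in decreasing order of `v`. -/
noncomputable def descRank (W : Finset ι) (v : ι → ℝ) (a : ι) : ℕ :=
  (W.filter fun b => v a ≤ v b).card

lemma descRank_lt {W : Finset ι} {v : ι → ℝ} {a a' : ι} (ha : a ∈ W) (h : v a < v a') :
    descRank W v a' < descRank W v a := by
  refine Finset.card_lt_card (Finset.ssubset_iff_of_subset ?_ |>.2 ⟨a, ?_, ?_⟩)
  · intro b
    simp only [Finset.mem_filter]
    exact fun hb => ⟨hb.1, h.le.trans hb.2⟩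
  · simp [ha]
  · simp [h]

lemma le_of_descRank_le {W : Finset ι} {v : ι → ℝ} {a a' : ι} (ha' : a' ∈ W)
    (h : descRank W v a' ≤ descRank W v a) : v a ≤ v a' :=
  le_of_not_gt fun hlt => (descRank_lt ha' hlt).not_ge h

lemma descRank_bijOn {W : Finset ι} {v : ι → ℝ} (hv : Function.Injective v) :
    Set.BijOn (descRank W v) W (Set.Icc 1 W.card) := by
  have hmaps : Set.MapsTo (descRank W v) W (Finset.Icc 1 W.card) := fun a ha => by
    refine Finset.mem_coe.2 (Finset.mem_Icc.2 ⟨?_, Finset.card_filter_le _ _⟩)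
    exact Finset.card_pos.2 ⟨a, Finset.mem_filter.2 ⟨ha, le_rfl⟩⟩
  have hinj : Set.InjOn (descRank W v) W := fun a ha a' ha' h =>
    hv ((le_of_descRank_le ha' h.ge).antisymm (le_of_descRank_le ha h.le))
  rw [← Finset.coe_Icc]
  exact ⟨hmaps, hinj, Finset.surjOn_of_injOn_of_card_le _ hmaps hinj (by simp)⟩

lemma one_add_card_filter_erase [DecidableEq ι] {W : Finset ι} {v : ι → ℝ} {a : ι} (ha : a ∈ W) (x : ℝ) :
    1 + ((W.erase a).filter fun b => x ≤ v b).card =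
      (W.filter fun b => x ≤ v b).card + if x ≤ v a then 0 else 1 := by
  rw [Finset.filter_erase]
  split_ifs with h
  · rw [Finset.card_erase_of_mem (Finset.mem_filter.2 ⟨ha, h⟩)]
    have : 0 < (W.filter fun b => x ≤ v b).card :=
      Finset.card_pos.2 ⟨a, Finset.mem_filter.2 ⟨ha, h⟩⟩
    omega
  · rw [Finset.erase_eq_of_notMem (by simp [h]), add_comm]

lemma card_filter_lt_descRank {W : Finset ι} {v : ι → ℝ} {a : ι} (ha : a ∈ W) {x : ℝ}
    (h : v a < x) : (W.filter fun b => x ≤ v b).card < descRank W v a := by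
  refine Finset.card_lt_card (Finset.ssubset_iff_of_subset ?_ |>.2 ⟨a, ?_, ?_⟩)
  · intro b
    simp only [Finset.mem_filter]
    exact fun hb => ⟨hb.1, h.le.trans hb.2⟩
  · simp [ha]
  · simp [h]

lemma sum_comp_swap_erase [DecidableEq ι] {W : Finset ι} {e a : ι} (he : e ∈ W) (ha : a ∈ W) (f : ι → ℝ) :
    ∑ b ∈ W.erase e, f (Equiv.swap e a b) = ∑ b ∈ W.erase a, f b := by
  refine Finset.sum_equiv (Equiv.swap e a) (fun b => ?_) fun _ _ => rfl
  rw [Equiv.swap_apply_def]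
  simp only [Finset.mem_erase]
  split_ifs <;> grind

end Rank

/-! ### Effect of a swap on grouped p-values -/

section GroupedPValue

variable {κ : Type*} [DecidableEq κ] {n m : ℕ}

/-- The calibration indices in the group of the test point `i`. -/
def groupIndices (g : Fin (n + m) → κ) (i : Fin m) : Finset (Fin n) :=
  Finset.univ.filter fun j => g (Fin.castAdd m j) = g (Fin.natAdd n i)

/-- The conformal `p`-value of the test point `i` computed from the vector `v` of all scores,
with the calibration points in the group of `i`. -/
noncomputable def groupPValue (g : Fin (n + m) → κ) (v : Fin (n + m) → ℝ) (i : Fin m) : ℝ :=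
  (1 / (((groupIndices g i).card : ℝ) + 1)) *
    (1 + ∑ j ∈ groupIndices g i, if v (Fin.natAdd n i) ≤ v (Fin.castAdd m j) then (1 : ℝ) else 0)

/-- The test point `i` together with the calibration points of its group. -/
def groupWindow (g : Fin (n + m) → κ) (i : Fin m) : Finset (Fin (n + m)) :=
  insert (Fin.natAdd n i) ((groupIndices g i).map (Fin.castAddEmb m))

lemma natAdd_notMem_map_groupIndices (g : Fin (n + m) → κ) (i l : Fin m) :
    Fin.natAdd n l ∉ (groupIndices g i).map (Fin.castAddEmb m) := by
  simp only [Finset.mem_map, not_exists, not_and]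
  intro j _ h
  have := congrArg Fin.val h
  simp at this
  omega

lemma natAdd_mem_groupWindow (g : Fin (n + m) → κ) (i : Fin m) :
    Fin.natAdd n i ∈ groupWindow g i := Finset.mem_insert_self _ _

lemma card_groupWindow (g : Fin (n + m) → κ) (i : Fin m) :
    (groupWindow g i).card = (groupIndices g i).card + 1 := by
  rw [groupWindow, Finset.card_insert_of_notMem (natAdd_notMem_map_groupIndices g i i),
    Finset.card_map]

lemma eq_of_mem_groupWindow {g : Fin (n + m) → κ} {i : Fin m} {a : Fin (n + m)}
    (ha : a ∈ groupWindow g i) : g a = g (Fin.natAdd n i) := by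
  rcases Finset.mem_insert.1 ha with rfl | ha
  · rfl
  · obtain ⟨j, hj, rfl⟩ := Finset.mem_map.1 ha
    exact (Finset.mem_filter.1 hj).2

lemma natAdd_mem_groupWindow_iff {g : Fin (n + m) → κ} {i l : Fin m} :
    Fin.natAdd n l ∈ groupWindow g i ↔ l = i := by
  rw [groupWindow, Finset.mem_insert, or_iff_left (natAdd_notMem_map_groupIndices g i l)]
  simp

lemma measurable_groupPValue (g : Fin (n + m) → κ) : Measurable (groupPValue g) := by
  refine measurable_pi_lambda _ fun i => measurable_const.mul (measurable_const.add ?_)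
  refine Finset.measurable_sum _ fun j _ => Measurable.ite ?_ measurable_const measurable_const
  exact measurableSet_le (measurable_pi_apply _) (measurable_pi_apply _)

lemma groupPValue_swap_of_ne {g : Fin (n + m) → κ} {i l : Fin m} {a : Fin (n + m)}
    (ha : a ∈ groupWindow g i) (hl : g (Fin.natAdd n l) ≠ g (Fin.natAdd n i))
    (v : Fin (n + m) → ℝ) :
    groupPValue g (v ∘ Equiv.swap (Fin.natAdd n i) a) l = groupPValue g v l := by
  have hswap : ∀ b, g b = g (Fin.natAdd n l) → Equiv.swap (Fin.natAdd n i) a b = b := by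
    intro b hb
    refine Equiv.swap_apply_of_ne_of_ne ?_ ?_
    · rintro rfl
      exact hl hb.symm
    · rintro rfl
      exact hl (hb.symm.trans (eq_of_mem_groupWindow ha))
  unfold groupPValue
  congr 2
  refine Finset.sum_congr rfl fun j hj => ?_
  rw [Function.comp_apply, Function.comp_apply, hswap _ rfl, hswap _ (Finset.mem_filter.1 hj).2]

/-- After the swap the calibration scores are those of the window without `a`. Hence, for fixed `x`,
the choice of `a` matters only through the comparison of `x` with `v a`. -/
lemma groupPValue_swap_of_eq {g : Fin (n + m) → κ} {i l : Fin m} {a : Fin (n + m)}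
    (ha : a ∈ groupWindow g i) (hl : g (Fin.natAdd n l) = g (Fin.natAdd n i))
    (v : Fin (n + m) → ℝ) (x : ℝ)
    (hx : v (Equiv.swap (Fin.natAdd n i) a (Fin.natAdd n l)) = x) :
    groupPValue g (v ∘ Equiv.swap (Fin.natAdd n i) a) l =
      ((((groupWindow g i).filter fun b => x ≤ v b).card + if x ≤ v a then 0 else 1 : ℕ) : ℝ) /
        ((groupWindow g i).card : ℝ) := by
  have hD : groupIndices g l = groupIndices g i := by simp only [groupIndices, hl]
  have hmap : (groupIndices g i).map (Fin.castAddEmb m) =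
      (groupWindow g i).erase (Fin.natAdd n i) := by
    rw [groupWindow, Finset.erase_insert (natAdd_notMem_map_groupIndices g i i)]
  have hsum : ∑ j ∈ groupIndices g i, (if x ≤ v (Equiv.swap (Fin.natAdd n i) a (Fin.castAdd m j))
      then (1 : ℝ) else 0) = (((groupWindow g i).erase a).filter fun b => x ≤ v b).card := by
    rw [Finset.card_filter, Nat.cast_sum]
    simp only [Nat.cast_ite, Nat.cast_one, Nat.cast_zero]
    rw [← sum_comp_swap_erase (natAdd_mem_groupWindow g i) ha
      (fun b => if x ≤ v b then (1 : ℝ) else 0), ← hmap, Finset.sum_map]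
    rfl
  rw [← one_add_card_filter_erase ha]
  unfold groupPValue
  simp only [Function.comp_apply, hx, hD]
  rw [hsum, card_groupWindow]
  push_cast
  ring

lemma groupPValue_swap_self {g : Fin (n + m) → κ} {i : Fin m} {a : Fin (n + m)}
    (ha : a ∈ groupWindow g i) (v : Fin (n + m) → ℝ) :
    groupPValue g (v ∘ Equiv.swap (Fin.natAdd n i) a) i =
      (descRank (groupWindow g i) v a : ℝ) / ((groupWindow g i).card : ℝ) := by
  rw [groupPValue_swap_of_eq ha rfl v (v a) (by rw [Equiv.swap_apply_left])]
  simp [descRank]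

lemma groupPValue_swap_eq_or_le {g : Fin (n + m) → κ} {i : Fin m} {a a' : Fin (n + m)}
    (ha : a ∈ groupWindow g i) (ha' : a' ∈ groupWindow g i) (v : Fin (n + m) → ℝ)
    (h : descRank (groupWindow g i) v a' ≤ descRank (groupWindow g i) v a) (l : Fin m) :
    groupPValue g (v ∘ Equiv.swap (Fin.natAdd n i) a') l =
        groupPValue g (v ∘ Equiv.swap (Fin.natAdd n i) a) l ∨
      (groupPValue g (v ∘ Equiv.swap (Fin.natAdd n i) a') l ≤
          groupPValue g (v ∘ Equiv.swap (Fin.natAdd n i) a) i ∧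
        groupPValue g (v ∘ Equiv.swap (Fin.natAdd n i) a) l ≤
          groupPValue g (v ∘ Equiv.swap (Fin.natAdd n i) a) i) := by
  have hle : v a ≤ v a' := le_of_descRank_le ha' h
  by_cases hl : g (Fin.natAdd n l) = g (Fin.natAdd n i)
  · by_cases hli : l = i
    · subst hli
      refine Or.inr ⟨?_, le_rfl⟩
      rw [groupPValue_swap_self ha, groupPValue_swap_self ha']
      gcongr
    · have hx : ∀ b ∈ groupWindow g i,
          v (Equiv.swap (Fin.natAdd n i) b (Fin.natAdd n l)) = v (Fin.natAdd n l) := by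
        intro b hb
        rw [Equiv.swap_apply_of_ne_of_ne]
        · simpa using hli
        · rintro rfl
          exact hli (natAdd_mem_groupWindow_iff.1 hb)
      rw [groupPValue_swap_of_eq ha hl v _ (hx a ha), groupPValue_swap_of_eq ha' hl v _ (hx a' ha'),
        groupPValue_swap_self ha]
      -- If the score of `l` is at most `v a ≤ v a'`, neither swap adds the extra 1. Otherwise its
      -- count is strictly below the rank of `a`, which leaves room for that 1.
      by_cases h1 : v (Fin.natAdd n l) ≤ v a
      · left
        simp only [h1, h1.trans hle, if_true]
      · have h2 := card_filter_lt_descRank ha (not_le.1 h1)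
        right
        constructor <;> gcongr <;> split_ifs <;> omega
  · left
    rw [groupPValue_swap_of_ne ha hl, groupPValue_swap_of_ne ha' hl]

lemma sum_stepUpWeight_groupPValue_swap {g : Fin (n + m) → κ} {i : Fin m} {c : ℕ} {t : ℝ}
    (hc : 0 < c) (hcM : c * m ≤ (groupWindow g i).card) (ht : t * (groupWindow g i).card = c)
    {v : Fin (n + m) → ℝ} (hv : Function.Injective v) :
    ∑ a ∈ groupWindow g i,
      stepUpWeight t i (groupPValue g (v ∘ Equiv.swap (Fin.natAdd n i) a)) = c :=
  sum_stepUpWeight_of_bijOn _ _ (descRank_bijOn hv) _ i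
    (Finset.card_pos.2 ⟨_, natAdd_mem_groupWindow g i⟩) hc hcM ht
    (fun _ ha => groupPValue_swap_self ha v)
    (fun _ ha _ ha' h => groupPValue_swap_eq_or_le ha ha' v h)

/-! ### Expected weights and exactness under exchangeability -/

lemma lintegral_stepUpWeight_groupPValue (ν : Measure (Fin (n + m) → ℝ)) [IsProbabilityMeasure ν]
    {g : Fin (n + m) → κ}
    (hinv : ∀ i j, g i = g j → ν.map (fun v => v ∘ Equiv.swap i j) = ν)
    (hinj : ∀ᵐ v ∂ν, Function.Injective v) {i : Fin m} {c : ℕ} {t : ℝ}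
    (hc : 0 < c) (hcM : c * m ≤ (groupWindow g i).card) (ht : t * (groupWindow g i).card = c) :
    ∫⁻ v, stepUpWeight t i (groupPValue g v) ∂ν = ENNReal.ofReal t := by
  have hmeas : Measurable fun v => stepUpWeight t i (groupPValue g v) :=
    (measurable_stepUpWeight t i).comp (measurable_groupPValue g)
  have hswap : ∀ a, Measurable fun v : Fin (n + m) → ℝ => v ∘ Equiv.swap (Fin.natAdd n i) a :=
    fun a => measurable_pi_lambda _ fun _ => measurable_pi_apply _
  have hM : 0 < (groupWindow g i).card := Finset.card_pos.2 ⟨_, natAdd_mem_groupWindow g i⟩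
  have h1 : ((groupWindow g i).card : ℝ≥0∞) * ∫⁻ v, stepUpWeight t i (groupPValue g v) ∂ν = c := by
    calc ((groupWindow g i).card : ℝ≥0∞) * ∫⁻ v, stepUpWeight t i (groupPValue g v) ∂ν
        = ∑ a ∈ groupWindow g i, ∫⁻ v, stepUpWeight t i
            (groupPValue g (v ∘ Equiv.swap (Fin.natAdd n i) a)) ∂ν := by
          rw [← nsmul_eq_mul, ← Finset.sum_const]
          refine Finset.sum_congr rfl fun a ha => ?_
          conv_lhs => rw [← hinv _ a (eq_of_mem_groupWindow ha).symm]
          exact lintegral_map hmeas (hswap a)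
      _ = ∫⁻ v, ∑ a ∈ groupWindow g i, stepUpWeight t i
            (groupPValue g (v ∘ Equiv.swap (Fin.natAdd n i) a)) ∂ν :=
          (lintegral_finsetSum _ fun a _ => hmeas.comp (hswap a)).symm
      _ = ∫⁻ _, (c : ℝ≥0∞) ∂ν := lintegral_congr_ae (hinj.mono fun v hv =>
          sum_stepUpWeight_groupPValue_swap hc hcM ht hv)
      _ = c := by simp
  have h2 : ((groupWindow g i).card : ℝ≥0∞) * ENNReal.ofReal t = c := by
    rw [← ENNReal.ofReal_natCast, ← ENNReal.ofReal_mul (Nat.cast_nonneg _), mul_comm, ht,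
      ENNReal.ofReal_natCast]
  exact (ENNReal.mul_right_inj (by exact_mod_cast hM.ne') (ENNReal.natCast_ne_top _)).1
    (h1.trans h2.symm)

lemma setOf_lt_simesCombination_groupPValue (hm : 1 ≤ m) (g : Fin (n + m) → κ) (α : ℝ) :
    {v | α < simesCombination (groupPValue g v)} =
      {v | 0 < stepUpCount (α / m) (groupPValue g v)}ᶜ := by
  ext v
  rw [Set.mem_compl_iff, Set.mem_ofPred_eq, Set.mem_ofPred_eq, ← simesCombination_le_iff hm,
    not_le]

/-- Exactness of the Simes test for conformal `p`-values of scores that are exchangeable within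
groups. -/
theorem measure_simesCombination_groupPValue (hm : 1 ≤ m) (ν : Measure (Fin (n + m) → ℝ))
    [IsProbabilityMeasure ν] (g : Fin (n + m) → κ)
    (hinv : ∀ i j, g i = g j → ν.map (fun v => v ∘ Equiv.swap i j) = ν)
    (hinj : ∀ᵐ v ∂ν, Function.Injective v) {α : ℝ} (hα0 : 0 < α) (hα1 : α < 1)
    (hint : ∀ i, ∃ z : ℤ, α * ((groupIndices g i).card + 1 : ℝ) / (m : ℝ) = z) :
    ν {v | α < simesCombination (groupPValue g v)} = ENNReal.ofReal (1 - α) := by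
  have hm0 : (0 : ℝ) < m := by exact_mod_cast hm
  have hR : Measurable fun v => stepUpCount (α / m) (groupPValue g v) :=
    (measurable_stepUpCount _).comp (measurable_groupPValue g)
  have hset : MeasurableSet {v | 0 < stepUpCount (α / m) (groupPValue g v)} :=
    measurableSet_lt measurable_const hR
  have hweight : ∀ i : Fin m, ∫⁻ v, stepUpWeight (α / m) i (groupPValue g v) ∂ν =
      ENNReal.ofReal (α / m) := by
    intro i
    obtain ⟨z, hz⟩ := hint i
    have hz0 : 0 < z := by
      have : (0 : ℝ) < z := by rw [← hz]; positivity
      exact_mod_cast this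
    obtain ⟨c, rfl⟩ := Int.eq_ofNat_of_zero_le hz0.le
    have ht : α / m * (groupWindow g i).card = c := by
      rw [card_groupWindow, div_mul_eq_mul_div]
      push_cast
      rw [hz]
      simp
    refine lintegral_stepUpWeight_groupPValue ν hinv hinj (by exact_mod_cast hz0) ?_ ht
    -- Here `c * m` is α times the window size, and α < 1.
    have : (c * m : ℝ) ≤ (groupWindow g i).card := by
      rw [← ht, div_mul_eq_mul_div, div_mul_cancel₀ _ hm0.ne']
      exact mul_le_of_le_one_left (Nat.cast_nonneg _) hα1.le
    exact_mod_cast this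
  have hrej : ν {v | 0 < stepUpCount (α / m) (groupPValue g v)} = ENNReal.ofReal α := by
    calc ν {v | 0 < stepUpCount (α / m) (groupPValue g v)}
        = ∫⁻ v, ∑ i, stepUpWeight (α / m) i (groupPValue g v) ∂ν := by
          rw [← lintegral_indicator_one hset]
          refine lintegral_congr fun v => ?_
          rw [sum_stepUpWeight (by positivity), Set.indicator_apply]
          rfl
      _ = ∑ i : Fin m, ENNReal.ofReal (α / m) := by
          refine (lintegral_finsetSum _ fun i _ =>
            (measurable_stepUpWeight _ i).comp (measurable_groupPValue g)).trans ?_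
          exact Finset.sum_congr rfl fun i _ => hweight i
      _ = ENNReal.ofReal α := by
          rw [Finset.sum_const, Finset.card_univ, Fintype.card_fin, nsmul_eq_mul,
            ← ENNReal.ofReal_natCast, ← ENNReal.ofReal_mul hm0.le, mul_div_cancel₀ _ hm0.ne']
  rw [setOf_lt_simesCombination_groupPValue hm, prob_compl_eq_one_sub hset, hrej, ENNReal.ofReal_sub _ hα0.le, ENNReal.ofReal_one]

/-! ### Independent scores are exchangeable within groups -/

lemma map_comp_swap_pi {ι : Type*} [Fintype ι] [DecidableEq ι] (L : ι → Measure ℝ)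
    [∀ i, SigmaFinite (L i)] {i j : ι} (h : L i = L j) :
    (Measure.pi L).map (fun v => v ∘ Equiv.swap i j) = Measure.pi L := by
  have hL : (fun k => L (Equiv.swap i j k)) = L := by
    ext1 k
    rw [Equiv.swap_apply_def]
    split_ifs with h1 h2
    · rw [h1, h]
    · rw [h2, h]
    · rfl
  have h := (measurePreserving_piCongrLeft L (Equiv.swap i j)).map_eq
  rw [hL] at h
  convert h using 2
  ext v k
  obtain ⟨k, rfl⟩ := (Equiv.swap i j).surjective k
  rw [MeasurableEquiv.coe_piCongrLeft, Equiv.piCongrLeft_apply_apply, Function.comp_apply,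
    Equiv.swap_apply_self]

/-- Exactness of the Simes test for independent scores whose laws only depend on the group. -/
theorem measure_simesCombination_of_iIndepFun {Ω : Type*} [MeasurableSpace Ω] (μ : Measure Ω)
    [IsProbabilityMeasure μ] (hm : 1 ≤ m) {V : Fin (n + m) → Ω → ℝ} (hV : ∀ i, Measurable (V i))
    (hindep : iIndepFun V μ) (g : Fin (n + m) → κ)
    (hlaw : ∀ i j, g i = g j → μ.map (V i) = μ.map (V j))
    (hinj : ∀ᵐ ω ∂μ, Function.Injective fun i => V i ω) {α : ℝ} (hα0 : 0 < α) (hα1 : α < 1)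
    (hint : ∀ i, ∃ z : ℤ, α * ((groupIndices g i).card + 1 : ℝ) / (m : ℝ) = z) :
    μ {ω | α < simesCombination (groupPValue g fun i => V i ω)} = ENNReal.ofReal (1 - α) := by
  have hVm : Measurable fun ω i => V i ω := measurable_pi_lambda _ hV
  have : ∀ i, IsProbabilityMeasure (μ.map (V i)) := fun i =>
    Measure.isProbabilityMeasure_map (hV i).aemeasurable
  have hpi := (iIndepFun_iff_map_fun_eq_pi_map fun i => (hV i).aemeasurable).1 hindep
  have hset : MeasurableSet {v : Fin (n + m) → ℝ | α < simesCombination (groupPValue g v)} := by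
    rw [setOf_lt_simesCombination_groupPValue hm]
    exact (measurableSet_lt measurable_const
      ((measurable_stepUpCount _).comp (measurable_groupPValue g))).compl
  have hinjset : MeasurableSet {v : Fin (n + m) → ℝ | Function.Injective v} := by
    simp only [Function.Injective, Set.ofPred_forall]
    refine MeasurableSet.iInter fun i => MeasurableSet.iInter fun j => ?_
    exact (measurableSet_eq_fun (measurable_pi_apply i) (measurable_pi_apply j)).imp
      (MeasurableSet.const _)
  have : IsProbabilityMeasure (μ.map fun ω i => V i ω) :=
    Measure.isProbabilityMeasure_map hVm.aemeasurable
  rw [← measure_simesCombination_groupPValue hm (μ.map fun ω i => V i ω) g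
    (fun i j hij => by rw [hpi]; exact map_comp_swap_pi _ (hlaw i j hij))
    ((ae_map_iff hVm.aemeasurable hinjset).2 hinj) hα0 hα1 hint, Measure.map_apply hVm hset]
  rfl

end GroupedPValue

/-! ### The two models -/

theorem theorem2 {Ω 𝒳 : Type*} [MeasurableSpace Ω] [MeasurableSpace 𝒳]
    (μ : Measure Ω) [IsProbabilityMeasure μ] {n m K : ℕ} (hm : 1 ≤ m)
    (S : Fin K → 𝒳 → ℝ) (hS : ∀ k, Measurable (S k))
    (X : Fin (n + m) → Ω → 𝒳) (hX : ∀ i, Measurable (X i))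
    (Y : Fin (n + m) → Ω → Fin K) (hY : ∀ i, Measurable (Y i))
    (hties : ∀ᵐ ω ∂μ, Function.Injective fun i => S (Y i ω) (X i ω))
    (α : ℝ) (hα0 : 0 < α) (hα1 : α < 1) :
    (IsIIDModel μ X Y →
      (∃ z : ℤ, α * ((n : ℝ) + 1) / (m : ℝ) = (z : ℝ)) →
      μ (fullCoverEvent S α X Y) = ENNReal.ofReal (1 - α)) ∧
    (IsConditionalModel μ X Y →
      ∀ y : Fin (n + m) → Fin K, μ (labelEvent Y y) ≠ 0 →
      (∀ k : Fin K, ∃ z : ℤ,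
        α * (((classIndices fun j : Fin n => y (Fin.castAdd m j)) k).card + 1 : ℝ) / (m : ℝ)
          = (z : ℝ)) →
      μ[|labelEvent Y y] (classCoverEvent S α X Y) = ENNReal.ofReal (1 - α)) := by
  refine ⟨fun hiid hz => ?_, fun hcond y hy hint => ?_⟩
  · have hF : Measurable fun q : 𝒳 × Fin K => S q.2 q.1 :=
      measurable_from_prod_countable_left hS
    have hD : ∀ i : Fin m, groupIndices (n := n) (fun _ : Fin (n + m) => ()) i = Finset.univ :=
      fun i => by simp [groupIndices]
    have h := measure_simesCombination_of_iIndepFun μ hm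
      (V := fun i ω => S (Y i ω) (X i ω)) (fun i => hF.comp ((hX i).prodMk (hY i)))
      (hiid.indep.comp _ fun _ => hF) (fun _ => ())
      (fun i j _ => ((hiid.ident i j).comp hF).map_eq) hties hα0 hα1
      (fun i => by simpa [hD] using hz)
    rw [← h]
    congr 1
    ext ω
    change α < simesCombination _ ↔ α < simesCombination _
    congr! 2
    ext i
    simp only [groupPValue, hD]
    rfl
  · obtain ⟨Q, hQ⟩ := hcond
    obtain ⟨hindep, hlaw⟩ := hQ y hy
    have hE : MeasurableSet (labelEvent Y y) := by
      simp only [labelEvent, Set.ofPred_forall]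
      exact MeasurableSet.iInter fun i => hY i (measurableSet_singleton (y i))
    have hprob : IsProbabilityMeasure (μ[|labelEvent Y y]) := cond_isProbabilityMeasure hy
    have hlabel : ∀ᵐ ω ∂(μ[|labelEvent Y y]), ∀ i, Y i ω = y i := ae_cond_mem hE
    have h := measure_simesCombination_of_iIndepFun (μ[|labelEvent Y y]) hm
      (V := fun i ω => S (y i) (X i ω)) (fun i => (hS _).comp (hX i))
      (hindep.comp _ fun i => hS (y i)) y
      (fun i j hij => by
        have hmap : ∀ i, (μ[|labelEvent Y y]).map (fun ω => S (y i) (X i ω)) =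
            (Q (y i)).map (S (y i)) := fun i => by
          rw [← hlaw i, Measure.map_map (hS _) (hX i)]
          rfl
        rw [hmap, hmap, hij])
      (by
        -- Absence of ties passes to the conditional measure by absolute continuity.
        filter_upwards [cond_absolutelyContinuous.ae_le hties, hlabel] with ω h1 h2
        simpa only [h2] using h1)
      hα0 hα1 (fun i => hint (y (Fin.natAdd n i)))
    rw [← h]
    refine measure_congr ?_
    filter_upwards [hlabel] with ω hω
    refine propext ?_
    change α < simesCombination _ ↔ α < simesCombination _
    simp only [classPValue, conformalPValue, hω]
    rfl
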